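/- Let $m$ be the normalized Lebesgue measure on the unit circle $\mathbb T$, let $\mathbb D$ be the open unit disk, and let $\mu = w\,dm+\mu_s$ be a probability measure on $\mathbb T$ (with $\mu_s$ singular to $m$) in the Szegő class, i.e. $\log w\in L^1(\mathbb T)$. Its Schur family $\{f_n\}_{n\ge 0}$ of analytic functions in $\mathbb D$ is defined by $$\frac{1+zf_0(z)}{1-zf_0(z)}=\int_{\mathbb T}\frac{1+\bar\xi z}{1-\bar\xi z}\,d\mu(\xi),\qquad zf_{n+1}(z)=\frac{f_n(z)-f_n(0)}{1-\overline{f_n(0)}f_n(z)},\qquad z\in\mathbb D,\ n\ge 0.$$ For $z\in\mathbb D$ put $\mathcal P(\mu,z)=\int_{\mathbb T}\frac{1-|z|^2}{|1-\bar\xi z|^2}\,d\mu(\xi)$, $\mathcal P(v,z)=\mathcal P(v\,dm,z)$ for $v\in L^1(\mathbb T)$, and $\mathcal K(\mu,z)=\log\mathcal P(\mu,z)-\mathcal P(\log w,z)$. There is an absolute constant $c$ such that for every such $\mu$ and every $n\ge 0$ the function $f_n$ has nontangential boundary values (again denoted by $f_n$) $m$-almost everywhere on $\mathbb T$, and $$\mathcal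 P(|f_n-f_n(z)|,z)\le c\,\sqrt{\mathcal K(\mu,z)}\qquad\text{for all } z\in\mathbb D,$$ where on the left-hand side $f_n$ stands for its boundary function on $\mathbb T$ and $f_n(z)$ is a constant. -/

import Mathlib

open MeasureTheory Filter Topology

noncomputable section

namespace UnitCircle

/- The Borel structure on the unit circle (as the subtype of `ℂ`). -/

instance : MeasurableSpace Circle := borel Circle

instance : BorelSpace Circle := ⟨rfl⟩

/-- Lebesgue measure `m` on the unit circle, normalized by `m(𝕋) = 1`: the image of
`dθ / (2π)` on `(0, 2π]` under `θ ↦ exp (i θ)`. -/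
def lebesgue : Measure Circle :=
  (ENNReal.ofReal (2 * Real.pi))⁻¹ •
    (volume.restrict (Set.Ioc 0 (2 * Real.pi))).map (fun θ : ℝ => Circle.exp θ)

/-- The density `w` of the absolutely continuous part of `μ = w dm + μ_s`. -/
def density (μ : Measure Circle) (ξ : Circle) : ℝ := (μ.rnDeriv lebesgue ξ).toReal

/-- The Szegő class: probability measures on the circle with `log w ∈ L¹(m)`.  Since
`Real.log 0 = 0`, the part of `log w ∈ L¹(m)` which says that `log w` is finite almost everywhere,
that is, `w > 0` almost everywhere, is written separately. -/
structure IsSzego (μ : Measure Circle) : Prop where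
  isProbabilityMeasure : IsProbabilityMeasure μ
  density_pos : ∀ᵐ ξ ∂lebesgue, 0 < density μ ξ
  integrable_log : Integrable (fun ξ => Real.log (density μ ξ)) lebesgue

/-- The Poisson integral `∫ (1 - |z|²) / |1 - ξ̄ z|² dμ(ξ)` of a measure; on `|ξ| = 1` the kernel is
`(|ξ|² - |z|²) / |ξ - z|²`. -/
def poissonMeasure (μ : Measure Circle) (z : ℂ) : ℝ :=
  ∫ ξ : Circle, poissonKernel 0 z (ξ : ℂ) ∂μ

/-- The Poisson integral `∫ v(ξ) (1 - |z|²) / |1 - ξ̄ z|² dm(ξ)` of a function. -/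
def poisson (v : Circle → ℝ) (z : ℂ) : ℝ :=
  ∫ ξ : Circle, v ξ * poissonKernel 0 z (ξ : ℂ) ∂lebesgue

/-- The entropy function `K(μ, z) = log P(μ, z) - P(log w, z)`. -/
def entropy (μ : Measure Circle) (z : ℂ) : ℝ :=
  Real.log (poissonMeasure μ z) - poisson (fun ξ => Real.log (density μ ξ)) z

/-- The Herglotz integral `F(z) = ∫ (1 + ξ̄ z) / (1 - ξ̄ z) dμ(ξ)`; on `|ξ| = 1` the kernel is
`(ξ + z) / (ξ - z)`. -/
def herglotz (μ : Measure Circle) (z : ℂ) : ℂ :=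
  ∫ ξ : Circle, herglotzRieszKernel 0 z (ξ : ℂ) ∂μ

/-- The Schur function `f` of a probability measure, defined in the unit disk by
`(1 + z f(z)) / (1 - z f(z)) = F(z)`, that is, `z f(z) = (F(z) - 1) / (F(z) + 1)`.  Here
`dslope g 0 z` is `(g z - g 0) / z` for `z ≠ 0` and `g' 0` for `z = 0`, and `F(0) = 1`. -/
def schurFunction (μ : Measure Circle) : ℂ → ℂ :=
  dslope (fun z => (herglotz μ z - 1) / (herglotz μ z + 1)) 0

/-- The Schur family: `f₀` is the Schur function of `μ`, and
`z f_{n+1}(z) = (f_n(z) - f_n(0)) / (1 - conj (f_n(0)) f_n(z))`. -/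
def schurFamily (μ : Measure Circle) : ℕ → ℂ → ℂ
  | 0 => schurFunction μ
  | n + 1 => dslope (fun z => (schurFamily μ n z - schurFamily μ n 0) /
      (1 - (starRingEnd ℂ) (schurFamily μ n 0) * schurFamily μ n z)) 0

/-- The Stolz angle at `ξ`: the convex hull of the disk of radius `ρ` and the point `ξ`,
with the point `ξ` itself removed. -/
def stolz (ρ : ℝ) (ξ : Circle) : Set ℂ :=
  convexHull ℝ (Metric.ball (0 : ℂ) ρ ∪ {(ξ : ℂ)}) \ {(ξ : ℂ)}

/-- Nontangential approach to `ξ`: convergence along it means convergence as `z → ξ` inside every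
Stolz angle at `ξ`. -/
def nontangential (ξ : Circle) : Filter ℂ :=
  ⨆ ρ ∈ Set.Ioo (0 : ℝ) 1, 𝓝[stolz ρ ξ] (ξ : ℂ)

/-- The nontangential boundary value of `f` at `ξ` (meaningful where the limit exists). -/
def boundaryValue (f : ℂ → ℂ) (ξ : Circle) : ℂ := limUnder (nontangential ξ) f

end UnitCircle

end

namespace UnitCircle

open Metric ComplexConjugate

/-! Everything rests on an inequality that survives the Schur algorithm: with `K` the entropy, P(log
1/(1 - |f|²), z) - log 1/(1 - |f(z)|²) ≤ K(z), recorded as `SchurEntropyBound f K`. A Möbius map (f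
- a)/(1 - āf) does not change the left side, because it alters log(1 - |f|²) only by a constant and
by the harmonic function -2 log|1 - āf|. Division by z does not increase it: boundary moduli stay
the same and interior moduli do not decrease. So every f_n satisfies the bound with the same K, once
z f_0 does.

For z f_0 = (F - 1)/(F + 1), with F the Herglotz integral, 1 - |z f_0|² = Re F / |(F + 1)/2|², Re F
= P(μ, ·), and log|(F + 1)/2| is harmonic. Jensen's inequality P(log w) ≤ log P(μ, ·) bounds -log(1
- |z f_0|²) inside the disk by a harmonic function. Averaging over smaller circles and applying
Fatou's lemma moves this to the boundary, so the boundary values of F itself are never needed.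

To conclude at a point z, take a = f(z). The transformed function s vanishes at z, hence P(|s|², z)
≤ -P(log(1 - |s|²), z) ≤ K(z); also |f - f(z)| ≤ 2|s| on the circle, and Cauchy-Schwarz finishes
(`SchurEntropyBound.poisson_norm_sub_le`).

Boundary values come from Fatou's theorem, proved by differentiating a Lipschitz primitive along the
circle (`ae_exists_tendsto_nontangential`). -/

/-! ### Normalized Lebesgue measure on the circle. -/

lemma measurableEmbedding_exp :
    MeasurableEmbedding ((Set.Ioc 0 (2 * Real.pi)).domRestrict (fun θ : ℝ => Circle.exp θ)) :=
  ContinuousOn.measurableEmbedding measurableSet_Ioc Circle.exp.continuous.continuousOn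
    (Circle.exp_injOn_Ioc (by simp))

/-- Factoring through the subtype makes this a push-forward along a measurable embedding, so null
sets and integrals transfer with no measurability assumption. -/
lemma map_exp_restrict : (volume.restrict (Set.Ioc 0 (2 * Real.pi))).map
      (fun θ : ℝ => Circle.exp θ) =
    (volume.comap ((↑) : Set.Ioc 0 (2 * Real.pi) → ℝ)).map
      ((Set.Ioc 0 (2 * Real.pi)).domRestrict (fun θ : ℝ => Circle.exp θ)) := by
  rw [← map_comap_subtype_coe measurableSet_Ioc,
    Measure.map_map Circle.exp.continuous.measurable measurable_subtype_coe]
  rfl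

lemma ae_lebesgue_of_ae {p : Circle → Prop} (h : ∀ᵐ θ : ℝ, p (Circle.exp θ)) :
    ∀ᵐ ξ ∂lebesgue, p ξ := by
  refine Measure.ae_smul_measure ?_ _
  rw [map_exp_restrict, measurableEmbedding_exp.ae_map_iff]
  refine ((MeasurableEmbedding.subtype_coe measurableSet_Ioc).ae_map_iff
    (p := fun θ => p (Circle.exp θ))).1 ?_
  rw [map_comap_subtype_coe measurableSet_Ioc]
  exact ae_restrict_of_ae h

lemma integral_lebesgue {E : Type*} [NormedAddCommGroup E] [NormedSpace ℝ E] (F : ℂ → E) :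
    ∫ ξ : Circle, F ξ ∂lebesgue = Real.circleAverage F 0 1 := by
  rw [lebesgue, integral_smul_measure, map_exp_restrict, measurableEmbedding_exp.integral_map,
    Real.circleAverage, intervalIntegral.integral_of_le Real.two_pi_pos.le,
    ← integral_subtype_comap measurableSet_Ioc (fun θ => F (circleMap 0 1 θ)), ENNReal.toReal_inv,
    ENNReal.toReal_ofReal Real.two_pi_pos.le]
  simp [circleMap]

instance : IsProbabilityMeasure lebesgue := by
  refine ⟨?_⟩
  rw [lebesgue, Measure.smul_apply, Measure.map_apply Circle.exp.continuous.measurable .univ]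
  simp only [Set.preimage_univ, Measure.restrict_apply_univ, Real.volume_Ioc, sub_zero, smul_eq_mul]
  exact ENNReal.inv_mul_cancel (by simp [Real.pi_pos]) ENNReal.ofReal_ne_top

/-! ### The Poisson kernel. -/

lemma coe_sub_ne_zero (ξ : Circle) {z : ℂ} (hz : z ∈ ball (0 : ℂ) 1) : (ξ : ℂ) - z ≠ 0 := by
  rw [mem_ball_zero_iff] at hz
  intro h
  rw [sub_eq_zero] at h
  simp [← h, Circle.norm_coe] at hz

lemma poissonKernel_eq (z : ℂ) (ξ : Circle) :
    poissonKernel 0 z ξ = (1 - ‖z‖ ^ 2) / ‖(ξ : ℂ) - z‖ ^ 2 := by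
  simp [poissonKernel_def, Circle.norm_coe]

lemma re_herglotzRieszKernel (z w : ℂ) :
    (herglotzRieszKernel 0 z w).re = poissonKernel 0 z w := by
  rw [poissonKernel_eq_re_herglotzRieszKernel]; rfl

lemma poissonKernel_pos {z : ℂ} (hz : z ∈ ball (0 : ℂ) 1) (ξ : Circle) :
    0 < poissonKernel 0 z ξ := by
  rw [poissonKernel_eq]
  have := norm_pos_iff.2 (coe_sub_ne_zero ξ hz)
  rw [mem_ball_zero_iff] at hz
  have : 0 < 1 - ‖z‖ ^ 2 := by nlinarith [norm_nonneg z]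
  positivity

lemma continuous_herglotzRieszKernel {z : ℂ} (hz : z ∈ ball (0 : ℂ) 1) :
    Continuous fun ξ : Circle => herglotzRieszKernel 0 z ξ := by
  simp only [herglotzRieszKernel_def, sub_zero]
  exact Continuous.div (by fun_prop) (by fun_prop) fun ξ => coe_sub_ne_zero ξ hz

lemma continuous_poissonKernel {z : ℂ} (hz : z ∈ ball (0 : ℂ) 1) :
    Continuous fun ξ : Circle => poissonKernel 0 z ξ := by
  simp only [← re_herglotzRieszKernel]
  exact Complex.continuous_re.comp (continuous_herglotzRieszKernel hz)

lemma integrable_of_continuous {E : Type*} [NormedAddCommGroup E] {μ : Measure Circle}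
    [IsFiniteMeasure μ] {f : Circle → E} (hf : Continuous f) : Integrable f μ := by
  have := hf.continuousOn.integrableOn_compact (μ := μ) isCompact_univ
  rwa [integrableOn_univ] at this

lemma exists_poissonKernel_le {z : ℂ} (hz : z ∈ ball (0 : ℂ) 1) :
    ∃ C, ∀ ξ : Circle, ‖poissonKernel 0 z ξ‖ ≤ C := by
  obtain ⟨C, hC⟩ := isCompact_univ.exists_bound_of_continuousOn
    (continuous_poissonKernel hz).continuousOn
  exact ⟨C, fun ξ => hC ξ trivial⟩

lemma integrable_mul_poissonKernel {μ : Measure Circle} {v : Circle → ℝ} (hv : Integrable v μ)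
    {z : ℂ} (hz : z ∈ ball (0 : ℂ) 1) :
    Integrable (fun ξ : Circle => v ξ * poissonKernel 0 z ξ) μ := by
  obtain ⟨C, hC⟩ := exists_poissonKernel_le hz
  exact hv.mul_bdd (continuous_poissonKernel hz).aestronglyMeasurable (ae_of_all _ hC)

lemma integrable_poissonKernel_smul {μ : Measure Circle} {v : Circle → ℂ} (hv : Integrable v μ)
    {z : ℂ} (hz : z ∈ ball (0 : ℂ) 1) :
    Integrable (fun ξ : Circle => poissonKernel 0 z ξ • v ξ) μ := by
  obtain ⟨C, hC⟩ := exists_poissonKernel_le hz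
  exact hv.bdd_smul C (continuous_poissonKernel hz).aestronglyMeasurable (ae_of_all _ hC)

lemma integral_poissonKernel_smul_of_diffContOnCl {f : ℂ → ℂ} (hf : DiffContOnCl ℂ f (ball 0 1))
    {z : ℂ} (hz : z ∈ ball (0 : ℂ) 1) :
    ∫ ξ : Circle, poissonKernel 0 z ξ • f ξ ∂lebesgue = f z := by
  rw [integral_lebesgue (fun w => poissonKernel 0 z w • f w)]
  exact hf.circleAverage_poissonKernel_smul hz

lemma integral_poissonKernel {z : ℂ} (hz : z ∈ ball (0 : ℂ) 1) :
    ∫ ξ : Circle, poissonKernel 0 z ξ ∂lebesgue = 1 := by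
  have := integral_poissonKernel_smul_of_diffContOnCl (f := fun _ => 1) diffContOnCl_const hz
  simp only [Complex.real_smul, mul_one] at this
  rw [integral_complex_ofReal] at this
  exact_mod_cast this

/-! ### Dilations and radial limits. -/

lemma mul_mem_ball {r : ℝ} (hr : r ∈ Set.Ioo (0 : ℝ) 1) {z : ℂ} (hz : ‖z‖ ≤ 1) :
    (r : ℂ) * z ∈ ball (0 : ℂ) 1 := by
  rw [mem_ball_zero_iff, norm_mul, Complex.norm_real, Real.norm_of_nonneg hr.1.le]
  nlinarith [hr.1, hr.2]

lemma mul_coe_mem_ball {r : ℝ} (hr : r ∈ Set.Ioo (0 : ℝ) 1) (ξ : Circle) :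
    (r : ℂ) * ξ ∈ ball (0 : ℂ) 1 := mul_mem_ball hr (Circle.norm_coe ξ).le

lemma continuous_dilation {f : ℂ → ℂ} (hf : DifferentiableOn ℂ f (ball 0 1)) {r : ℝ}
    (hr : r ∈ Set.Ioo (0 : ℝ) 1) : Continuous fun ξ : Circle => f (r * ξ) :=
  hf.continuousOn.comp_continuous (by fun_prop) fun ξ => mul_coe_mem_ball hr ξ

lemma integral_poissonKernel_smul_dilation {f : ℂ → ℂ} (hf : DifferentiableOn ℂ f (ball 0 1))
    {z : ℂ} (hz : z ∈ ball (0 : ℂ) 1) {r : ℝ} (hr : r ∈ Set.Ioo (0 : ℝ) 1) :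
    ∫ ξ : Circle, poissonKernel 0 z ξ • f (r * ξ) ∂lebesgue = f (r * z) := by
  refine integral_poissonKernel_smul_of_diffContOnCl (f := fun w => f (r * w))
    (DifferentiableOn.diffContOnCl ?_) hz
  rw [closure_ball _ one_ne_zero]
  exact hf.comp (by fun_prop) fun w hw => mul_mem_ball hr (mem_closedBall_zero_iff.1 hw)

lemma integral_re_dilation {f : ℂ → ℂ} (hf : DifferentiableOn ℂ f (ball 0 1))
    {z : ℂ} (hz : z ∈ ball (0 : ℂ) 1) {r : ℝ} (hr : r ∈ Set.Ioo (0 : ℝ) 1) :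
    ∫ ξ : Circle, (f (r * ξ)).re * poissonKernel 0 z ξ ∂lebesgue = (f (r * z)).re := by
  have hi := integrable_poissonKernel_smul (μ := lebesgue)
    (integrable_of_continuous (continuous_dilation hf hr)) hz
  rw [← integral_poissonKernel_smul_dilation hf hz hr]
  refine Eq.trans ?_ (integral_re hi)
  simp [mul_comm]

lemma eventually_Ioo : ∀ᶠ r : ℝ in 𝓝[<] 1, r ∈ Set.Ioo (0 : ℝ) 1 :=
  Ioo_mem_nhdsLT one_pos

lemma tendsto_mul_nhdsLT (z : ℂ) : Tendsto (fun r : ℝ => (r : ℂ) * z) (𝓝[<] 1) (𝓝 z) := by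
  have : Continuous fun r : ℝ => (r : ℂ) * z := by fun_prop
  simpa using (this.tendsto 1).mono_left nhdsWithin_le_nhds

lemma tendsto_dilation {f : ℂ → ℂ} (hf : DifferentiableOn ℂ f (ball 0 1)) {z : ℂ}
    (hz : z ∈ ball (0 : ℂ) 1) : Tendsto (fun r : ℝ => f (r * z)) (𝓝[<] 1) (𝓝 (f z)) :=
  ((hf.continuousOn.continuousAt (isOpen_ball.mem_nhds hz)).tendsto).comp (tendsto_mul_nhdsLT z)

lemma aestronglyMeasurable_radial {f : ℂ → ℂ} (hf : DifferentiableOn ℂ f (ball 0 1))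
    {g : Circle → ℂ}
    (hg : ∀ᵐ ξ : Circle ∂lebesgue, Tendsto (fun r : ℝ => f (r * ξ)) (𝓝[<] 1) (𝓝 (g ξ))) :
    AEStronglyMeasurable g lebesgue := by
  obtain ⟨u, hu⟩ := exists_seq_tendsto (𝓝[<] (1 : ℝ))
  obtain ⟨N, hN⟩ := eventually_atTop.1 (hu.eventually eventually_Ioo)
  refine aestronglyMeasurable_of_tendsto_ae atTop
    (f := fun n (ξ : Circle) => f (u (n + N) * ξ)) (fun n => ?_) ?_
  · exact (continuous_dilation hf (hN _ (by simp))).aestronglyMeasurable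
  · filter_upwards [hg] with ξ hξ
    exact hξ.comp (hu.comp (tendsto_add_atTop_nat N))

lemma norm_radial_le {f : ℂ → ℂ} {M : ℝ} (hM : ∀ z ∈ ball (0 : ℂ) 1, ‖f z‖ ≤ M) {ξ : Circle}
    {l : ℂ} (hg : Tendsto (fun r : ℝ => f (r * ξ)) (𝓝[<] 1) (𝓝 l)) : ‖l‖ ≤ M :=
  le_of_tendsto hg.norm (eventually_Ioo.mono fun _ hr => hM _ (mul_coe_mem_ball hr ξ))

/-- The Poisson formula holds for w ↦ f(rw), which is holomorphic up to the boundary; dominated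
convergence lets r → 1. -/
lemma integral_poissonKernel_smul_radial {f : ℂ → ℂ} (hf : DifferentiableOn ℂ f (ball 0 1))
    {M : ℝ} (hM : ∀ z ∈ ball (0 : ℂ) 1, ‖f z‖ ≤ M) {g : Circle → ℂ}
    (hg : ∀ᵐ ξ : Circle ∂lebesgue, Tendsto (fun r : ℝ => f (r * ξ)) (𝓝[<] 1) (𝓝 (g ξ)))
    {z : ℂ} (hz : z ∈ ball (0 : ℂ) 1) :
    ∫ ξ : Circle, poissonKernel 0 z ξ • g ξ ∂lebesgue = f z := by
  refine tendsto_nhds_unique ?_ (tendsto_dilation hf hz)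
  refine Tendsto.congr' (eventually_Ioo.mono fun r hr =>
    integral_poissonKernel_smul_dilation hf hz hr) ?_
  refine tendsto_integral_filter_of_dominated_convergence (fun ξ => ‖poissonKernel 0 z ξ‖ * M)
    ?_ ?_ ?_ ?_
  · filter_upwards [eventually_Ioo] with r hr
    exact ((continuous_poissonKernel hz).smul (continuous_dilation hf hr)).aestronglyMeasurable
  · filter_upwards [eventually_Ioo] with r hr
    refine ae_of_all _ fun ξ => ?_
    rw [norm_smul]
    exact mul_le_mul_of_nonneg_left (hM _ (mul_coe_mem_ball hr ξ)) (norm_nonneg _)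
  · exact (integrable_of_continuous (continuous_poissonKernel hz).norm).mul_const M
  · filter_upwards [hg] with ξ hξ
    exact hξ.const_smul _

/-! ### Fatou's theorem on nontangential limits. -/

lemma ae_ne (ξ₀ : Circle) : ∀ᵐ ξ ∂lebesgue, ξ ≠ ξ₀ := by
  refine ae_lebesgue_of_ae ?_
  have h := ((Set.countable_singleton (ξ₀ : ℂ)).preimage_circleMap 0 one_ne_zero).measure_zero volume
  filter_upwards [measure_eq_zero_iff_ae_notMem.1 h] with θ hθ heq
  refine hθ ?_
  rw [← heq]
  simp [circleMap]

/-- With C = 2/(1 - ρ), the function |w - ξ| + C|w| is convex and at most C both on the disk of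
radius ρ and at ξ, hence on their convex hull. -/
lemma stolz_subset {ρ : ℝ} (hρ : ρ ∈ Set.Ioo (0 : ℝ) 1) (ξ : Circle) {z : ℂ}
    (hz : z ∈ stolz ρ ξ) :
    z ∈ ball (0 : ℂ) 1 ∧ ‖z - ξ‖ ≤ 2 / (1 - ρ) * (1 - ‖z‖) := by
  have hρ' : 0 < 1 - ρ := by linarith [hρ.2]
  have hC : 0 < 2 / (1 - ρ) := by positivity
  have hconv : ConvexOn ℝ Set.univ fun w : ℂ => ‖w - ξ‖ + 2 / (1 - ρ) * ‖w‖ := by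
    refine ConvexOn.add ?_ ((convexOn_norm convex_univ).smul hC.le)
    have := (convexOn_norm (E := ℂ) convex_univ).translate_left (-(ξ : ℂ))
    simpa [sub_eq_add_neg, Function.comp_def] using this
  have hsub : convexHull ℝ (ball (0 : ℂ) ρ ∪ {(ξ : ℂ)}) ⊆
      {w | w ∈ Set.univ ∧ ‖w - ξ‖ + 2 / (1 - ρ) * ‖w‖ ≤ 2 / (1 - ρ)} := by
    refine convexHull_min ?_ (hconv.convex_le _)
    rintro w (hw | hw)
    · refine ⟨trivial, ?_⟩
      rw [mem_ball_zero_iff] at hw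
      have h1 : ‖w - ξ‖ ≤ ‖w‖ + 1 := by simpa [Circle.norm_coe] using norm_sub_le w (ξ : ℂ)
      have h2 : 2 / (1 - ρ) * (1 - ‖w‖) ≥ 2 := by
        rw [ge_iff_le, div_mul_eq_mul_div, le_div_iff₀ hρ']
        linarith
      nlinarith [hρ.2]
    · rw [Set.mem_singleton_iff] at hw
      simp [hw, Circle.norm_coe]
  have h := (hsub hz.1).2
  have h' : ‖z - ξ‖ ≤ 2 / (1 - ρ) * (1 - ‖z‖) := by linarith
  refine ⟨?_, h'⟩
  have hpos : 0 < ‖z - ξ‖ := norm_pos_iff.2 (sub_ne_zero.2 hz.2)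
  rw [mem_ball_zero_iff]
  nlinarith [(mul_pos_iff_of_pos_left hC).1 (hpos.trans_le h')]

/-- Split the Poisson average of q - A at distance δ from ξ: near ξ the integrand is controlled by
ε, and farther away |ζ - z| ≥ δ/2 makes the kernel small. -/
lemma norm_sub_le_of_boundary {Q : ℂ → ℂ} (hQ : DifferentiableOn ℂ Q (ball 0 1)) {M : ℝ}
    (hM : ∀ z ∈ ball (0 : ℂ) 1, ‖Q z‖ ≤ M) {q : Circle → ℂ}
    (hq : ∀ᵐ ζ : Circle ∂lebesgue, Tendsto (fun r : ℝ => Q (r * ζ)) (𝓝[<] 1) (𝓝 (q ζ)))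
    {ξ : Circle} {A : ℂ} {ε δ : ℝ} (hδ : 0 < δ)
    (hε : ∀ ζ : Circle, ‖(ζ : ℂ) - ξ‖ < δ → ‖q ζ - A‖ ≤ ε) {z : ℂ} (hz : z ∈ ball (0 : ℂ) 1)
    (hzξ : ‖z - ξ‖ < δ / 2) :
    ‖Q z - A‖ ≤ ε + (M + ‖A‖) * ((1 - ‖z‖ ^ 2) / (δ / 2) ^ 2) := by
  have hM0 : 0 ≤ M := (norm_nonneg _).trans (hM 0 (by simp))
  have hε0 : 0 ≤ ε := (norm_nonneg _).trans (hε ξ (by simpa using hδ))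
  have hqM : ∀ᵐ ζ ∂lebesgue, ‖q ζ‖ ≤ M := hq.mono fun ζ h => norm_radial_le hM h
  have hqi : Integrable q lebesgue := Integrable.of_bound (aestronglyMeasurable_radial hQ hq) M hqM
  have hPi := integrable_of_continuous (μ := lebesgue) (continuous_poissonKernel hz)
  have hz' : 0 ≤ 1 - ‖z‖ ^ 2 := by
    rw [mem_ball_zero_iff] at hz
    nlinarith [norm_nonneg z]
  have key : Q z - A = ∫ ζ : Circle, poissonKernel 0 z ζ • (q ζ - A) ∂lebesgue := by
    simp only [smul_sub]
    rw [integral_sub (integrable_poissonKernel_smul hqi hz) (hPi.smul_const A),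
      integral_poissonKernel_smul_radial hQ hM hq hz, integral_smul_const,
      integral_poissonKernel hz, one_smul]
  have hbound : ∀ᵐ ζ : Circle ∂lebesgue, ‖poissonKernel 0 z ζ • (q ζ - A)‖ ≤
      poissonKernel 0 z ζ * ε + (M + ‖A‖) * ((1 - ‖z‖ ^ 2) / (δ / 2) ^ 2) := by
    filter_upwards [hqM] with ζ hζ
    have hP := poissonKernel_pos hz ζ
    rw [norm_smul, Real.norm_of_nonneg hP.le]
    rcases lt_or_ge ‖(ζ : ℂ) - ξ‖ δ with h | h
    · refine (mul_le_mul_of_nonneg_left (hε ζ h) hP.le).trans (le_add_of_nonneg_right ?_)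
      positivity
    · have h1 : ‖q ζ - A‖ ≤ M + ‖A‖ := (norm_sub_le _ _).trans (by gcongr)
      have h2 : δ / 2 ≤ ‖(ζ : ℂ) - z‖ := by
        have := norm_sub_le_norm_sub_add_norm_sub (ζ : ℂ) z ξ
        linarith
      have h3 : poissonKernel 0 z ζ ≤ (1 - ‖z‖ ^ 2) / (δ / 2) ^ 2 := by
        rw [poissonKernel_eq]
        gcongr
      have h4 := mul_le_mul h3 h1 (norm_nonneg _) (hP.le.trans h3)
      have : 0 ≤ poissonKernel 0 z ζ * ε := by positivity
      linarith
  rw [key]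
  refine (norm_integral_le_of_norm_le ((hPi.mul_const ε).add (integrable_const _)) hbound).trans_eq ?_
  simp only [Pi.add_apply]
  rw [integral_add (hPi.mul_const ε) (integrable_const _), integral_mul_const,
    integral_poissonKernel hz]
  simp

/-- A bounded holomorphic function on the disk whose boundary function is continuous at a point has
an unrestricted limit there. -/
lemma tendsto_of_tendsto_boundary {Q : ℂ → ℂ} (hQ : DifferentiableOn ℂ Q (ball 0 1)) {M : ℝ}
    (hM : ∀ z ∈ ball (0 : ℂ) 1, ‖Q z‖ ≤ M) {q : Circle → ℂ}
    (hq : ∀ᵐ ζ : Circle ∂lebesgue, Tendsto (fun r : ℝ => Q (r * ζ)) (𝓝[<] 1) (𝓝 (q ζ)))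
    {ξ : Circle} {A : ℂ} (hA : Tendsto q (𝓝 ξ) (𝓝 A)) :
    Tendsto Q (𝓝[ball 0 1] (ξ : ℂ)) (𝓝 A) := by
  rw [Metric.tendsto_nhds]
  intro ε hε
  obtain ⟨δ, hδ, h⟩ := Metric.tendsto_nhds_nhds.1 hA (ε / 2) (half_pos hε)
  have hlim : Tendsto (fun z : ℂ => ε / 2 + (M + ‖A‖) * ((1 - ‖z‖ ^ 2) / (δ / 2) ^ 2))
      (𝓝[ball 0 1] (ξ : ℂ)) (𝓝 (ε / 2)) := by
    have : Continuous fun z : ℂ => ε / 2 + (M + ‖A‖) * ((1 - ‖z‖ ^ 2) / (δ / 2) ^ 2) := by fun_prop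
    simpa [Circle.norm_coe] using (this.tendsto (ξ : ℂ)).mono_left nhdsWithin_le_nhds
  filter_upwards [hlim.eventually_lt_const (half_lt_self hε), self_mem_nhdsWithin,
    nhdsWithin_le_nhds (ball_mem_nhds (ξ : ℂ) (half_pos hδ))] with z h1 hz hzξ
  rw [dist_eq_norm]
  refine (norm_sub_le_of_boundary hQ hM hq hδ (fun ζ hζ => ?_) hz
    (by rwa [mem_ball, dist_eq_norm] at hzξ)).trans_lt h1
  have h2 : dist ζ ξ < δ := (dist_eq_norm (ζ : ℂ) ξ).trans_lt hζ
  exact (dist_eq_norm (q ζ) A ▸ h h2).le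

/-- The difference quotient of a function along the circle converges to the quotient of the angular
derivatives. -/
lemma exists_continuousAt_slope {g : ℂ → ℂ} {θ : ℝ}
    (hg : DifferentiableAt ℝ (fun t => g (circleMap 0 1 t)) θ) :
    ∃ q : Circle → ℂ, ContinuousAt q (Circle.exp θ) ∧ ∀ ζ : Circle, ζ ≠ Circle.exp θ →
      q ζ = (g ζ - g (Circle.exp θ)) / (ζ - Circle.exp θ) := by
  set ξ := Circle.exp θ with hξ
  have hc : ∀ t, circleMap 0 1 t = Circle.exp t := fun t => by simp [circleMap]
  -- An angle function with the branch of the argument centred at ξ, hence continuous there.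
  let t : Circle → ℝ := fun ζ => θ + Complex.arg ((ζ / ξ : Circle) : ℂ)
  have ht : ContinuousAt t ξ := by
    refine continuousAt_const.add (ContinuousAt.comp (g := Complex.arg)
      (f := fun ζ : Circle => ((ζ / ξ : Circle) : ℂ)) ?_ ?_)
    · refine Complex.continuousAt_arg ?_
      simp
    · have : Continuous fun ζ : Circle => ((ζ / ξ : Circle) : ℂ) := by
        simp only [Circle.coe_div]
        fun_prop (disch := simp)
      exact this.continuousAt
  have htξ : t ξ = θ := by simp [t]
  have hexp : ∀ ζ, Circle.exp (t ζ) = ζ := fun ζ => by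
    simp only [t, Circle.exp_add, Circle.exp_arg]
    rw [← hξ]
    exact mul_div_cancel _ _
  have hd := (differentiable_circleMap 0 1) θ
  have hne : dslope (circleMap 0 1) θ θ ≠ 0 := by
    rw [dslope_same]
    exact deriv_circleMap_ne_zero one_ne_zero
  -- The two divided differences in the angle share the factor 1/(t - θ), which cancels; at θ they
  -- become the derivatives, and that of the circle parametrization is nonzero.
  refine ⟨fun ζ => dslope (fun t => g (circleMap 0 1 t)) θ (t ζ) / dslope (circleMap 0 1) θ (t ζ),
    ?_, fun ζ hζ => ?_⟩
  · refine ContinuousAt.div ?_ ?_ (by rwa [htξ])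
    · refine ContinuousAt.comp (g := dslope (fun t => g (circleMap 0 1 t)) θ) ?_ ht
      rw [htξ]
      exact continuousAt_dslope_same.2 hg
    · refine ContinuousAt.comp (g := dslope (circleMap 0 1) θ) ?_ ht
      rw [htξ]
      exact continuousAt_dslope_same.2 hd
  · have h1 : t ζ ≠ θ := by
      intro h
      exact hζ (by rw [hξ, ← h, hexp])
    have h2 : ((t ζ - θ : ℝ) : ℂ) ≠ 0 := by exact_mod_cast sub_ne_zero.2 h1
    beta_reduce
    rw [dslope_of_ne _ h1, dslope_of_ne _ h1]
    simp only [slope_def_module, hc, hexp, ← hξ, Complex.real_smul, Complex.ofReal_inv]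
    rw [mul_div_mul_left _ _ (inv_ne_zero h2)]

/-- A primitive that is differentiable at `ξ` relative to the disk has a derivative with a
nontangential limit at `ξ`. -/
lemma tendsto_nontangential_of_slope {f g : ℂ → ℂ} (hg : ∀ z ∈ ball (0 : ℂ) 1, HasDerivAt g (f z) z)
    {ξ : Circle} {A : ℂ}
    (hA : Tendsto (fun z => (g z - g ξ) / (z - ξ)) (𝓝[ball 0 1] (ξ : ℂ)) (𝓝 A)) :
    Tendsto f (nontangential ξ) (𝓝 A) := by
  refine tendsto_iSup.2 fun ρ => tendsto_iSup.2 fun hρ => ?_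
  have hC : 0 < 2 / (1 - ρ) := div_pos two_pos (by linarith [hρ.2])
  rw [Metric.tendsto_nhdsWithin_nhds]
  intro ε hε
  -- With C = 2/(1 - ρ), Cauchy's estimate below on a circle of radius d/2 gives ε/(4(C + 1)) · (C +
  -- 1)d / (d/2) = ε/2.
  obtain ⟨δ, hδ, h⟩ := Metric.tendsto_nhdsWithin_nhds.1 hA (ε / (4 * (2 / (1 - ρ) + 1)))
    (by positivity)
  refine ⟨δ / 2, half_pos hδ, fun z hz hzξ => ?_⟩
  obtain ⟨hzb, hzC⟩ := stolz_subset hρ ξ hz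
  rw [dist_eq_norm] at hzξ ⊢
  set d := 1 - ‖z‖ with hd
  have hd0 : 0 < d := by rw [mem_ball_zero_iff] at hzb; linarith
  have hd1 : d ≤ ‖z - ξ‖ := by
    have := norm_sub_norm_le (ξ : ℂ) z
    rw [Circle.norm_coe, norm_sub_rev] at this
    exact this
  have hsub : closedBall z (d / 2) ⊆ ball 0 1 := by
    intro w hw
    rw [mem_closedBall, dist_eq_norm] at hw
    rw [mem_ball_zero_iff]
    have := norm_sub_norm_le w z
    linarith
  -- H is the error of the first-order expansion of g at ξ, and H' = f - A. In the Stolz angle |z -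
  -- ξ| ≤ Cd, so H is small relative to d on the circle about z.
  set H : ℂ → ℂ := fun w => g w - g ξ - A * (w - ξ) with hH
  have hHd : ∀ w ∈ ball (0 : ℂ) 1, HasDerivAt H (f w - A) w := fun w hw =>
    (((hg w hw).sub_const (g ξ)).sub
      (((hasDerivAt_id w).sub_const (ξ : ℂ)).const_mul A)).congr_deriv (by simp)
  have hHc : DiffContOnCl ℂ H (ball z (d / 2)) := by
    refine DifferentiableOn.diffContOnCl fun w hw => ?_
    rw [closure_ball _ (half_pos hd0).ne'] at hw
    exact (hHd w (hsub hw)).differentiableAt.differentiableWithinAt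
  rw [← (hHd z hzb).deriv]
  refine (Complex.norm_deriv_le_of_forall_mem_sphere_norm_le (half_pos hd0) hHc
    (C := ε / (4 * (2 / (1 - ρ) + 1)) * ((2 / (1 - ρ) + 1) * d)) fun w hw => ?_).trans_lt ?_
  · have hwb := hsub (sphere_subset_closedBall hw)
    rw [mem_sphere, dist_eq_norm] at hw
    have h1 : ‖w - ξ‖ ≤ ‖z - ξ‖ + d / 2 := by
      have := norm_sub_le_norm_sub_add_norm_sub w z (ξ : ℂ)
      linarith
    have h2 := h hwb (by rw [dist_eq_norm]; linarith)
    have hne : w - ξ ≠ 0 := by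
      rw [← neg_ne_zero, neg_sub]
      exact coe_sub_ne_zero ξ hwb
    have h3 : H w = ((g w - g ξ) / (w - ξ) - A) * (w - ξ) := by
      simp only [hH]
      field_simp
    rw [h3, norm_mul]
    rw [dist_eq_norm] at h2
    refine mul_le_mul h2.le ?_ (norm_nonneg _) (by positivity)
    nlinarith
  · have : ε / (4 * (2 / (1 - ρ) + 1)) * ((2 / (1 - ρ) + 1) * d) / (d / 2) = ε / 2 := by
      field_simp
      ring
    rw [this]
    exact half_lt_self hε

/-- **Fatou's theorem**: a bounded holomorphic function on the disk has nontangential limits almost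
everywhere. -/
theorem ae_exists_tendsto_nontangential {f : ℂ → ℂ} (hf : DifferentiableOn ℂ f (ball 0 1)) {M : ℝ}
    (hM : ∀ z ∈ ball (0 : ℂ) 1, ‖f z‖ ≤ M) :
    ∀ᵐ ξ ∂lebesgue, ∃ l : ℂ, Tendsto f (nontangential ξ) (𝓝 l) := by
  have hM0 : 0 ≤ M := (norm_nonneg _).trans (hM 0 (by simp))
  obtain ⟨G, hG⟩ := hf.isExactOn_ball
  have hGL : LipschitzOnWith M.toNNReal G (ball 0 1) := by
    refine (convex_ball (0 : ℂ) 1).lipschitzOnWith_of_nnnorm_hasDerivWithin_le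
      (fun z hz => (hG z hz).hasDerivWithinAt) fun z hz => ?_
    rw [← NNReal.coe_le_coe, coe_nnnorm, Real.coe_toNNReal _ hM0]
    exact hM z hz
  -- The primitive is Lipschitz because f is bounded; the extension supplies its values on the
  -- circle.
  obtain ⟨g, hgL, hgG⟩ := hGL.extend_finite_dimension
  set L := lipschitzExtensionConstant ℂ * M.toNNReal
  have hg : ∀ z ∈ ball (0 : ℂ) 1, HasDerivAt g (f z) z := fun z hz =>
    (hG z hz).congr_of_eventuallyEq
      (eventually_of_mem (isOpen_ball.mem_nhds hz) fun w hw => (hgG hw).symm)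
  refine ae_lebesgue_of_ae ?_
  have hgc : LipschitzWith (L * Real.nnabs 1) fun t => g (circleMap 0 1 t) :=
    hgL.comp (lipschitzWith_circleMap 0 1)
  filter_upwards [hgc.ae_differentiableAt_real] with θ hθ
  obtain ⟨q, hqc, hq⟩ := exists_continuousAt_slope hθ
  set ξ := Circle.exp θ
  refine ⟨q ξ, tendsto_nontangential_of_slope hg ?_⟩
  -- The difference quotient of g at ξ is holomorphic in the disk, bounded by the Lipschitz
  -- constant, and has boundary function q away from ξ.
  refine tendsto_of_tendsto_boundary (M := L) (q := q) ?_ ?_ ?_ hqc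
  · intro z hz
    have hne : z - ξ ≠ 0 := by
      rw [← neg_ne_zero, neg_sub]
      exact coe_sub_ne_zero ξ hz
    exact (((hg z hz).differentiableAt.sub_const _).div (by fun_prop) hne).differentiableWithinAt
  · intro z hz
    rw [norm_div]
    refine div_le_of_le_mul₀ (norm_nonneg _) L.2 ?_
    exact hgL.norm_sub_le z ξ
  · filter_upwards [ae_ne ξ] with ζ hζ
    rw [hq ζ hζ]
    have hne : (ζ : ℂ) - ξ ≠ 0 := sub_ne_zero.2 (Circle.coe_inj.not.2 hζ)
    have : ContinuousAt (fun z => (g z - g ξ) / (z - ξ)) (ζ : ℂ) :=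
      ((hgL.continuous.continuousAt).sub continuousAt_const).div (by fun_prop) hne
    exact this.tendsto.comp (tendsto_mul_nhdsLT (ζ : ℂ))

/-! ### Boundary values and Poisson averages. -/

lemma tendsto_radial_nontangential (ξ : Circle) :
    Tendsto (fun r : ℝ => (r : ℂ) * ξ) (𝓝[<] 1) (nontangential ξ) := by
  refine Tendsto.mono_right (y := 𝓝[stolz (1 / 2) ξ] (ξ : ℂ)) ?_
    (le_iSup₂_of_le (1 / 2 : ℝ) (by norm_num) le_rfl)
  refine tendsto_nhdsWithin_iff.2 ⟨tendsto_mul_nhdsLT _, eventually_Ioo.mono fun r hr => ⟨?_, ?_⟩⟩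
  · have h0 : (0 : ℂ) ∈ convexHull ℝ (ball (0 : ℂ) (1 / 2) ∪ {(ξ : ℂ)}) :=
      subset_convexHull ℝ _ (Or.inl (by simp))
    have h1 : (ξ : ℂ) ∈ convexHull ℝ (ball (0 : ℂ) (1 / 2) ∪ {(ξ : ℂ)}) :=
      subset_convexHull ℝ _ (Or.inr rfl)
    have := convex_convexHull ℝ _ h0 h1 (sub_nonneg.2 hr.2.le) hr.1.le (by ring)
    simpa using this
  · intro h
    have := congrArg norm h
    rw [norm_mul, Circle.norm_coe, Complex.norm_real, Real.norm_of_nonneg hr.1.le] at this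
    linarith [hr.2]

instance (ξ : Circle) : (nontangential ξ).NeBot := (tendsto_radial_nontangential ξ).neBot

lemma ae_tendsto_boundaryValue {f : ℂ → ℂ} (hf : DifferentiableOn ℂ f (ball 0 1)) {M : ℝ}
    (hM : ∀ z ∈ ball (0 : ℂ) 1, ‖f z‖ ≤ M) :
    ∀ᵐ ξ ∂lebesgue, Tendsto f (nontangential ξ) (𝓝 (boundaryValue f ξ)) :=
  (ae_exists_tendsto_nontangential hf hM).mono fun _ h => tendsto_nhds_limUnder h

lemma nontangential_le_nhds (ξ : Circle) : nontangential ξ ≤ 𝓝 (ξ : ℂ) :=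
  iSup₂_le fun _ _ => nhdsWithin_le_nhds

lemma poisson_mono {u v : Circle → ℝ} (hu : Integrable u lebesgue) (hv : Integrable v lebesgue)
    (huv : u ≤ᵐ[lebesgue] v) {z : ℂ} (hz : z ∈ ball (0 : ℂ) 1) : poisson u z ≤ poisson v z := by
  refine integral_mono_ae (integrable_mul_poissonKernel hu hz) (integrable_mul_poissonKernel hv hz) ?_
  filter_upwards [huv] with ξ hξ
  exact mul_le_mul_of_nonneg_right hξ (poissonKernel_pos hz ξ).le

lemma poisson_congr {u v : Circle → ℝ} (huv : u =ᵐ[lebesgue] v) {z : ℂ} :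
    poisson u z = poisson v z := by
  refine integral_congr_ae ?_
  filter_upwards [huv] with ξ hξ
  rw [hξ]

lemma poisson_add {u v : Circle → ℝ} (hu : Integrable u lebesgue) (hv : Integrable v lebesgue)
    {z : ℂ} (hz : z ∈ ball (0 : ℂ) 1) :
    poisson (fun ξ => u ξ + v ξ) z = poisson u z + poisson v z := by
  simp only [poisson, add_mul]
  exact integral_add (integrable_mul_poissonKernel hu hz) (integrable_mul_poissonKernel hv hz)

lemma poisson_sub {u v : Circle → ℝ} (hu : Integrable u lebesgue) (hv : Integrable v lebesgue)
    {z : ℂ} (hz : z ∈ ball (0 : ℂ) 1) :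
    poisson (fun ξ => u ξ - v ξ) z = poisson u z - poisson v z := by
  simp only [poisson, sub_mul]
  exact integral_sub (integrable_mul_poissonKernel hu hz) (integrable_mul_poissonKernel hv hz)

lemma poisson_const_mul (c : ℝ) (v : Circle → ℝ) (z : ℂ) :
    poisson (fun ξ => c * v ξ) z = c * poisson v z := by
  simp only [poisson, mul_assoc, integral_const_mul]

lemma poisson_const (c : ℝ) {z : ℂ} (hz : z ∈ ball (0 : ℂ) 1) : poisson (fun _ => c) z = c := by
  simp only [poisson, integral_const_mul, integral_poissonKernel hz, mul_one]

lemma integral_re_mul_poissonKernel {f : ℂ → ℂ} (hf : DifferentiableOn ℂ f (ball 0 1)) {M : ℝ}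
    (hM : ∀ z ∈ ball (0 : ℂ) 1, ‖f z‖ ≤ M) {g : Circle → ℂ}
    (hg : ∀ᵐ ξ : Circle ∂lebesgue, Tendsto (fun r : ℝ => f (r * ξ)) (𝓝[<] 1) (𝓝 (g ξ))) :
    Integrable g lebesgue ∧ ∀ z ∈ ball (0 : ℂ) 1,
      ∫ ξ : Circle, (g ξ).re * poissonKernel 0 z ξ ∂lebesgue = (f z).re := by
  have hi : Integrable g lebesgue := Integrable.of_bound (aestronglyMeasurable_radial hf hg) M
    (hg.mono fun _ h => norm_radial_le hM h)
  refine ⟨hi, fun z hz => ?_⟩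
  rw [← integral_poissonKernel_smul_radial hf hM hg hz]
  refine Eq.trans ?_ (integral_re (integrable_poissonKernel_smul hi hz))
  simp [mul_comm]

/-! ### Schur functions, Möbius maps and the entropy bound. -/

lemma re_one_sub_pos {a w : ℂ} (ha : ‖a‖ < 1) (hw : ‖w‖ ≤ 1) : 0 < (1 - conj a * w).re := by
  have h1 : ‖conj a * w‖ < 1 := by
    rw [norm_mul, RCLike.norm_conj]
    nlinarith [norm_nonneg a, norm_nonneg w]
  have := (Complex.re_le_norm (conj a * w)).trans_lt h1
  rw [Complex.sub_re, Complex.one_re]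
  linarith

lemma one_sub_norm_sq_mobius (a w : ℂ) (h : 1 - conj a * w ≠ 0) :
    1 - ‖(w - a) / (1 - conj a * w)‖ ^ 2 =
      (1 - ‖a‖ ^ 2) * (1 - ‖w‖ ^ 2) / ‖1 - conj a * w‖ ^ 2 := by
  have h' : ‖1 - conj a * w‖ ^ 2 ≠ 0 := pow_ne_zero 2 (norm_ne_zero_iff.2 h)
  rw [norm_div, div_pow, eq_div_iff h', sub_mul, div_mul_cancel₀ _ h']
  simp only [← Complex.normSq_eq_norm_sq, Complex.normSq_apply, Complex.sub_re, Complex.sub_im,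
    Complex.mul_re, Complex.mul_im, Complex.conj_re, Complex.conj_im, Complex.one_re,
    Complex.one_im]
  ring

/-- Isolates the change under a Möbius map: a constant, and a term that is harmonic when w is a
holomorphic function. -/
lemma log_one_sub_norm_sq_mobius {a w : ℂ} (ha : ‖a‖ < 1) (hw : ‖w‖ < 1) :
    Real.log (1 - ‖(w - a) / (1 - conj a * w)‖ ^ 2) =
      Real.log (1 - ‖a‖ ^ 2) + Real.log (1 - ‖w‖ ^ 2)
        - 2 * Real.log ‖1 - conj a * w‖ := by
  have h : 1 - conj a * w ≠ 0 := fun h => by simpa [h] using re_one_sub_pos ha hw.le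
  have h1 : 1 - ‖a‖ ^ 2 ≠ 0 := by nlinarith [norm_nonneg a]
  have h2 : 1 - ‖w‖ ^ 2 ≠ 0 := by nlinarith [norm_nonneg w]
  rw [one_sub_norm_sq_mobius a w h, Real.log_div (mul_ne_zero h1 h2)
    (pow_ne_zero 2 (norm_ne_zero_iff.2 h)), Real.log_mul h1 h2, Real.log_pow]
  norm_cast

/-- `f` is a Schur function whose boundary entropy at `z` is at most `K z`. -/
structure SchurEntropyBound (f : ℂ → ℂ) (K : ℂ → ℝ) : Prop where
  differentiableOn : DifferentiableOn ℂ f (ball 0 1)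
  norm_le_one : ∀ z ∈ ball (0 : ℂ) 1, ‖f z‖ ≤ 1
  -- Not implied by the next field: `Real.log 0 = 0` would hide boundary values of modulus one.
  norm_boundaryValue_lt : ∀ᵐ ξ ∂lebesgue, ‖boundaryValue f ξ‖ < 1
  integrable_log : Integrable (fun ξ => Real.log (1 - ‖boundaryValue f ξ‖ ^ 2)) lebesgue
  neg_poisson_le : ∀ z ∈ ball (0 : ℂ) 1,
    -poisson (fun ξ => Real.log (1 - ‖boundaryValue f ξ‖ ^ 2)) z ≤ K z - Real.log (1 - ‖f z‖ ^ 2)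

lemma ae_tendsto_radial {f : ℂ → ℂ} (hf : DifferentiableOn ℂ f (ball 0 1))
    (h1 : ∀ z ∈ ball (0 : ℂ) 1, ‖f z‖ ≤ 1) :
    ∀ᵐ ξ : Circle ∂lebesgue,
      Tendsto (fun r : ℝ => f (r * ξ)) (𝓝[<] 1) (𝓝 (boundaryValue f ξ)) :=
  (ae_tendsto_boundaryValue hf h1).mono fun ξ h => h.comp (tendsto_radial_nontangential ξ)

lemma aestronglyMeasurable_boundaryValue {f : ℂ → ℂ} (hf : DifferentiableOn ℂ f (ball 0 1))
    (h1 : ∀ z ∈ ball (0 : ℂ) 1, ‖f z‖ ≤ 1) :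
    AEStronglyMeasurable (boundaryValue f) lebesgue :=
  aestronglyMeasurable_radial hf (ae_tendsto_radial hf h1)

/-- If |f(z)| = 1, the Poisson average of the boundary modulus is at least 1, impossible when that
modulus is below 1 almost everywhere. -/
lemma norm_lt_one {f : ℂ → ℂ} (hf : DifferentiableOn ℂ f (ball 0 1))
    (h1 : ∀ z ∈ ball (0 : ℂ) 1, ‖f z‖ ≤ 1)
    (h : ∀ᵐ ξ ∂lebesgue, ‖boundaryValue f ξ‖ < 1) {z : ℂ}
    (hz : z ∈ ball (0 : ℂ) 1) : ‖f z‖ < 1 := by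
  refine (h1 z hz).lt_of_ne fun heq => ?_
  have hi : Integrable (boundaryValue f) lebesgue :=
    Integrable.of_bound (aestronglyMeasurable_boundaryValue hf h1) 1 (h.mono fun _ h => h.le)
  have hPi := integrable_of_continuous (μ := lebesgue) (continuous_poissonKernel hz)
  have hni := integrable_mul_poissonKernel hi.norm hz
  have hle : 1 ≤ ∫ ξ : Circle, ‖boundaryValue f ξ‖ * poissonKernel 0 z ξ ∂lebesgue := by
    rw [← heq, ← integral_poissonKernel_smul_radial hf h1 (ae_tendsto_radial hf h1) hz]
    refine (norm_integral_le_integral_norm _).trans_eq (integral_congr_ae (ae_of_all _ fun ξ => ?_))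
    simp only [norm_smul, Real.norm_of_nonneg (poissonKernel_pos hz ξ).le, mul_comm]
  have hnn : 0 ≤ᵐ[lebesgue] fun ξ : Circle =>
      poissonKernel 0 z ξ - ‖boundaryValue f ξ‖ * poissonKernel 0 z ξ := by
    filter_upwards [h] with ξ hξ
    have := poissonKernel_pos hz ξ
    simp only [Pi.zero_apply]
    nlinarith
  have hzero := (integral_eq_zero_iff_of_nonneg_ae hnn (hPi.sub hni)).1 (le_antisymm (by
    rw [integral_sub hPi hni, integral_poissonKernel hz]
    linarith) (integral_nonneg_of_ae hnn))
  obtain ⟨ξ, h2, h3⟩ := (hzero.and h).exists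
  have := poissonKernel_pos hz ξ
  simp only [Pi.zero_apply] at h2
  nlinarith

/-- The values 1 - āf stay in a compact subset of the right half-plane, so their logarithm is
bounded and holomorphic and its real part is the Poisson integral of its boundary values. -/
lemma poisson_log_norm_one_sub {f : ℂ → ℂ} (hf : DifferentiableOn ℂ f (ball 0 1))
    (h1 : ∀ z ∈ ball (0 : ℂ) 1, ‖f z‖ ≤ 1)
    {a : ℂ} (ha : ‖a‖ < 1) :
    Integrable (fun ξ => Real.log ‖1 - conj a * boundaryValue f ξ‖) lebesgue ∧
    ∀ z ∈ ball (0 : ℂ) 1, poisson (fun ξ => Real.log ‖1 - conj a * boundaryValue f ξ‖) z =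
      Real.log ‖1 - conj a * f z‖ := by
  have hslit : ∀ w : ℂ, ‖w‖ ≤ 1 → 1 - conj a * w ∈ Complex.slitPlane := fun w hw =>
    Complex.mem_slitPlane_iff.2 (Or.inl (re_one_sub_pos ha hw))
  have hd : DifferentiableOn ℂ (fun z => Complex.log (1 - conj a * f z)) (ball 0 1) :=
    ((hf.const_mul _).const_sub 1).clog fun z hz => hslit _ (h1 z hz)
  have hcont : ContinuousOn (fun w => Complex.log (1 - conj a * w)) (closedBall 0 1) :=
    ContinuousOn.clog (by fun_prop) fun w hw => hslit w (mem_closedBall_zero_iff.1 hw)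
  obtain ⟨M, hM⟩ := (isCompact_closedBall (0 : ℂ) 1).exists_bound_of_continuousOn hcont
  have hlim : ∀ᵐ ξ : Circle ∂lebesgue, Tendsto (fun r : ℝ => Complex.log (1 - conj a * f (r * ξ)))
      (𝓝[<] 1) (𝓝 (Complex.log (1 - conj a * boundaryValue f ξ))) := by
    filter_upwards [ae_tendsto_radial hf h1] with ξ hξ
    exact ((hξ.const_mul _).const_sub 1).clog (hslit _ (norm_radial_le h1 hξ))
  obtain ⟨hi, hP⟩ := integral_re_mul_poissonKernel hd
    (fun z hz => hM _ (mem_closedBall_zero_iff.2 (h1 z hz))) hlim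
  simp only [Complex.log_re] at hP
  exact ⟨hi.re.congr (ae_of_all _ fun ξ => Complex.log_re _), hP⟩

lemma boundaryValue_mobius {f : ℂ → ℂ} (hf : DifferentiableOn ℂ f (ball 0 1))
    (h1 : ∀ z ∈ ball (0 : ℂ) 1, ‖f z‖ ≤ 1)
    {a : ℂ} (ha : ‖a‖ < 1) : ∀ᵐ ξ ∂lebesgue,
    boundaryValue (fun z => (f z - a) / (1 - conj a * f z)) ξ =
      (boundaryValue f ξ - a) / (1 - conj a * boundaryValue f ξ) := by
  filter_upwards [ae_tendsto_boundaryValue hf h1] with ξ hξ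
  refine Tendsto.limUnder_eq ((hξ.sub_const a).div ((hξ.const_mul _).const_sub 1) fun h => ?_)
  have := re_one_sub_pos ha (norm_radial_le h1 (hξ.comp (tendsto_radial_nontangential ξ)))
  simp [h] at this

variable {f : ℂ → ℂ} {K : ℂ → ℝ}

lemma SchurEntropyBound.norm_lt_one (h : SchurEntropyBound f K) {z : ℂ}
    (hz : z ∈ ball (0 : ℂ) 1) : ‖f z‖ < 1 :=
  UnitCircle.norm_lt_one h.differentiableOn h.norm_le_one h.norm_boundaryValue_lt hz

/-- Both sides of the bound change by the same amount, since log|1 - āf| is reproduced by its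
Poisson integral. -/
lemma SchurEntropyBound.mobius (h : SchurEntropyBound f K) {a : ℂ} (ha : ‖a‖ < 1) :
    SchurEntropyBound (fun z => (f z - a) / (1 - conj a * f z)) K := by
  have hne : ∀ w : ℂ, ‖w‖ ≤ 1 → 1 - conj a * w ≠ 0 := fun w hw h0 => by
    simpa [h0] using re_one_sub_pos ha hw
  have ha' : 0 < 1 - ‖a‖ ^ 2 := by nlinarith [norm_nonneg a]
  have hlt : ∀ w : ℂ, ‖w‖ < 1 → ‖(w - a) / (1 - conj a * w)‖ < 1 := fun w hw => by
    have h1 := one_sub_norm_sq_mobius a w (hne w hw.le)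
    have h2 : 0 < 1 - ‖w‖ ^ 2 := by nlinarith [norm_nonneg w]
    have h3 := norm_pos_iff.2 (hne w hw.le)
    have h4 : 0 < 1 - ‖(w - a) / (1 - conj a * w)‖ ^ 2 := by rw [h1]; positivity
    nlinarith [norm_nonneg ((w - a) / (1 - conj a * w))]
  have hbv := boundaryValue_mobius h.differentiableOn h.norm_le_one ha
  obtain ⟨hi, hP⟩ := poisson_log_norm_one_sub h.differentiableOn h.norm_le_one ha
  have hlog : (fun ξ => Real.log
      (1 - ‖boundaryValue (fun z => (f z - a) / (1 - conj a * f z)) ξ‖ ^ 2)) =ᵐ[lebesgue]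
      fun ξ => Real.log (1 - ‖a‖ ^ 2) + Real.log (1 - ‖boundaryValue f ξ‖ ^ 2) -
        2 * Real.log ‖1 - conj a * boundaryValue f ξ‖ := by
    filter_upwards [hbv, h.norm_boundaryValue_lt] with ξ h1 h2
    rw [h1, log_one_sub_norm_sq_mobius ha h2]
  refine ⟨?_, fun z hz => (hlt _ (h.norm_lt_one hz)).le, ?_, ?_, fun z hz => ?_⟩
  · exact (h.differentiableOn.sub_const a).div ((h.differentiableOn.const_mul _).const_sub 1)
      fun z hz => hne _ (h.norm_le_one z hz)
  · filter_upwards [hbv, h.norm_boundaryValue_lt] with ξ h1 h2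
    rw [h1]
    exact hlt _ h2
  · exact ((((integrable_const _).add h.integrable_log).sub (hi.const_mul 2))).congr hlog.symm
  · have hb := h.neg_poisson_le z hz
    have key : poisson (fun ξ => Real.log
        (1 - ‖boundaryValue (fun z => (f z - a) / (1 - conj a * f z)) ξ‖ ^ 2)) z =
        Real.log (1 - ‖a‖ ^ 2) + poisson (fun ξ => Real.log (1 - ‖boundaryValue f ξ‖ ^ 2)) z
          - 2 * Real.log ‖1 - conj a * f z‖ := by
      have hi' : Integrable (fun ξ => Real.log (1 - ‖a‖ ^ 2) +
          Real.log (1 - ‖boundaryValue f ξ‖ ^ 2)) lebesgue :=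
        (integrable_const _).add h.integrable_log
      rw [← hP z hz, poisson_congr hlog, poisson_sub hi' (hi.const_mul 2) hz,
        poisson_add (integrable_const _) h.integrable_log hz, poisson_const _ hz, poisson_const_mul]
    rw [key, log_one_sub_norm_sq_mobius ha (h.norm_lt_one hz)]
    linarith

lemma boundaryValue_dslope {s : ℂ → ℂ} (hs : DifferentiableOn ℂ s (ball 0 1))
    (h1 : ∀ z ∈ ball (0 : ℂ) 1, ‖s z‖ ≤ 1) (h0 : s 0 = 0) :
    ∀ᵐ ξ ∂lebesgue, ‖boundaryValue (dslope s 0) ξ‖ = ‖boundaryValue s ξ‖ := by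
  filter_upwards [ae_tendsto_boundaryValue hs h1] with ξ hξ
  have hid : Tendsto (fun z : ℂ => z⁻¹) (nontangential ξ) (𝓝 (ξ : ℂ)⁻¹) :=
    (tendsto_inv₀ ξ.coe_ne_zero).mono_left (nontangential_le_nhds ξ)
  have hlim : Tendsto (dslope s 0) (nontangential ξ) (𝓝 ((ξ : ℂ)⁻¹ * boundaryValue s ξ)) := by
    refine (hid.mul hξ).congr' ?_
    have : ∀ᶠ z in nontangential ξ, z ≠ 0 :=
      nontangential_le_nhds ξ (eventually_ne_nhds ξ.coe_ne_zero)
    filter_upwards [this] with z hz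
    rw [dslope_of_ne _ hz, slope_def_module, h0]
    simp
  rw [show boundaryValue (dslope s 0) ξ = _ from hlim.limUnder_eq, norm_mul, norm_inv,
    Circle.norm_coe, inv_one, one_mul]

/-- Dividing by z preserves the boundary modulus and can only enlarge |f(z)|, hence the right side;
Schwarz's lemma keeps the quotient a Schur function. -/
lemma SchurEntropyBound.dslope (h : SchurEntropyBound f K) (h0 : f 0 = 0) :
    SchurEntropyBound (dslope f 0) K := by
  have hbv := boundaryValue_dslope h.differentiableOn h.norm_le_one h0
  have hd : DifferentiableOn ℂ (_root_.dslope f 0) (ball 0 1) :=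
    (Complex.differentiableOn_dslope (ball_mem_nhds 0 one_pos)).2 h.differentiableOn
  have h1 : ∀ z ∈ ball (0 : ℂ) 1, ‖_root_.dslope f 0 z‖ ≤ 1 := fun z hz => by
    have := Complex.norm_dslope_le_div_of_mapsTo_ball h.differentiableOn (R₂ := 1)
      (fun w hw => by simpa [h0] using h.norm_le_one w hw) hz
    simpa using this
  have hb : ∀ᵐ ξ ∂lebesgue, ‖boundaryValue (_root_.dslope f 0) ξ‖ < 1 := by
    filter_upwards [hbv, h.norm_boundaryValue_lt] with ξ h1 h2
    rwa [h1]
  have hlog : (fun ξ => Real.log (1 - ‖boundaryValue (_root_.dslope f 0) ξ‖ ^ 2)) =ᵐ[lebesgue]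
      fun ξ => Real.log (1 - ‖boundaryValue f ξ‖ ^ 2) := by
    filter_upwards [hbv] with ξ h1
    rw [h1]
  refine ⟨hd, h1, hb, h.integrable_log.congr hlog.symm, fun z hz => ?_⟩
  have hp : poisson (fun ξ => Real.log (1 - ‖boundaryValue (_root_.dslope f 0) ξ‖ ^ 2)) z =
      poisson (fun ξ => Real.log (1 - ‖boundaryValue f ξ‖ ^ 2)) z :=
    poisson_congr hlog
  rw [hp]
  refine (h.neg_poisson_le z hz).trans (sub_le_sub_left (Real.log_le_log ?_ ?_) _)
  · have := UnitCircle.norm_lt_one hd h1 hb hz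
    nlinarith [norm_nonneg (_root_.dslope f 0 z)]
  · have h2 : f z = z * _root_.dslope f 0 z := by
      simpa [h0] using (sub_smul_dslope f 0 z).symm
    have h3 : ‖f z‖ ≤ ‖_root_.dslope f 0 z‖ := by
      rw [h2, norm_mul]
      exact mul_le_of_le_one_left (norm_nonneg _) (mem_ball_zero_iff.1 hz).le
    nlinarith [norm_nonneg (f z)]

/-- The Cauchy--Schwarz inequality for a Poisson average. -/
lemma poisson_le_sqrt {v : Circle → ℝ} (hv : Integrable v lebesgue)
    (hv2 : Integrable (fun ξ => v ξ ^ 2) lebesgue) {z : ℂ} (hz : z ∈ ball (0 : ℂ) 1) :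
    poisson v z ≤ √(poisson (fun ξ => v ξ ^ 2) z) := by
  refine Real.le_sqrt_of_sq_le ?_
  set t := poisson v z
  have hi : Integrable (fun ξ => v ξ ^ 2 - 2 * t * v ξ) lebesgue := hv2.sub (hv.const_mul _)
  have hi' : Integrable (fun ξ => v ξ ^ 2 - 2 * t * v ξ + t ^ 2) lebesgue :=
    hi.add (integrable_const _)
  -- The variance, that is, the Poisson average of (v - t)², is nonnegative.
  have h : poisson (fun _ => 0) z ≤ poisson (fun ξ => v ξ ^ 2 - 2 * t * v ξ + t ^ 2) z := by
    refine poisson_mono (integrable_const _) hi' (ae_of_all _ fun ξ => ?_) hz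
    beta_reduce
    nlinarith [sq_nonneg (v ξ - t)]
  rw [poisson_const _ hz, poisson_add hi (integrable_const _) hz,
    poisson_sub hv2 (hv.const_mul _) hz, poisson_const _ hz, poisson_const_mul] at h
  nlinarith

lemma SchurEntropyBound.integrable_norm_sub (h : SchurEntropyBound f K) (a : ℂ) :
    Integrable (fun ξ => ‖boundaryValue f ξ - a‖) lebesgue := by
  have hi : Integrable (boundaryValue f) lebesgue := Integrable.of_bound
    (aestronglyMeasurable_boundaryValue h.differentiableOn h.norm_le_one) 1
    (h.norm_boundaryValue_lt.mono fun _ h => h.le)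
  exact (hi.sub (integrable_const a)).norm

/-- Move f(z) to 0 by a Möbius map, so that the logarithm at z disappears from the bound, and use x
≤ -log(1 - x) with x = |s|². The factor 2 bounds |1 - conj(f(z)) f| on the circle. -/
theorem SchurEntropyBound.poisson_norm_sub_le (h : SchurEntropyBound f K) {z : ℂ}
    (hz : z ∈ ball (0 : ℂ) 1) :
    poisson (fun ξ => ‖boundaryValue f ξ - f z‖) z ≤ 2 * √(K z) := by
  have ha := h.norm_lt_one hz
  have hs := h.mobius ha
  have hbv := boundaryValue_mobius h.differentiableOn h.norm_le_one ha
  set s := fun w => (f w - f z) / (1 - conj (f z) * f w) with hsdef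
  have hsz : s z = 0 := by simp [hsdef]
  have hm := aestronglyMeasurable_boundaryValue hs.differentiableOn hs.norm_le_one
  have i1 : Integrable (fun ξ => ‖boundaryValue s ξ‖) lebesgue :=
    (Integrable.of_bound hm 1 (hs.norm_boundaryValue_lt.mono fun _ h => h.le)).norm
  have i2 : Integrable (fun ξ => ‖boundaryValue s ξ‖ ^ 2) lebesgue := by
    refine Integrable.of_bound (hm.norm.pow 2) 1 (hs.norm_boundaryValue_lt.mono fun _ h => ?_)
    rw [norm_pow, norm_norm]
    exact pow_le_one₀ (norm_nonneg _) h.le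
  have e1 : poisson (fun ξ => ‖boundaryValue f ξ - f z‖) z ≤
      poisson (fun ξ => 2 * ‖boundaryValue s ξ‖) z := by
    refine poisson_mono (h.integrable_norm_sub _) (i1.const_mul 2) ?_ hz
    filter_upwards [hbv, h.norm_boundaryValue_lt] with ξ h1 h2
    have hne : 1 - conj (f z) * boundaryValue f ξ ≠ 0 := fun h0 => by
      simpa [h0] using re_one_sub_pos ha h2.le
    have hle : ‖1 - conj (f z) * boundaryValue f ξ‖ ≤ 2 := by
      refine (norm_sub_le _ _).trans ?_
      rw [norm_one, norm_mul, RCLike.norm_conj]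
      nlinarith [norm_nonneg (f z), norm_nonneg (boundaryValue f ξ)]
    rw [h1, norm_div, mul_div_assoc', le_div_iff₀ (norm_pos_iff.2 hne), mul_comm]
    exact mul_le_mul_of_nonneg_right hle (norm_nonneg _)
  have e3 : poisson (fun ξ => ‖boundaryValue s ξ‖ ^ 2) z ≤ K z := by
    have hb := hs.neg_poisson_le z hz
    rw [hsz] at hb
    simp only [norm_zero, ne_eq, OfNat.ofNat_ne_zero, not_false_eq_true, zero_pow, sub_zero,
      Real.log_one] at hb
    refine le_trans ?_ hb
    have : -poisson (fun ξ => Real.log (1 - ‖boundaryValue s ξ‖ ^ 2)) z =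
        poisson (fun ξ => -Real.log (1 - ‖boundaryValue s ξ‖ ^ 2)) z := by
      simp only [poisson, neg_mul, integral_neg]
    rw [this]
    refine poisson_mono i2 hs.integrable_log.neg ?_ hz
    filter_upwards [hs.norm_boundaryValue_lt] with ξ h1
    have := Real.log_le_sub_one_of_pos (x := 1 - ‖boundaryValue s ξ‖ ^ 2)
      (by nlinarith [norm_nonneg (boundaryValue s ξ)])
    simp only [Pi.neg_apply]
    linarith
  rw [poisson_const_mul] at e1
  refine e1.trans (mul_le_mul_of_nonneg_left ?_ two_pos.le)
  exact (poisson_le_sqrt i1 i2 hz).trans (Real.sqrt_le_sqrt e3)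

/-! ### The Herglotz integral and the initial entropy bound. -/

lemma hasDerivAt_herglotzRieszKernel (ξ : Circle) {z : ℂ} (hz : z ∈ ball (0 : ℂ) 1) :
    HasDerivAt (fun z => herglotzRieszKernel 0 z ξ) (2 * ξ / (ξ - z) ^ 2) z := by
  simp only [herglotzRieszKernel_def, sub_zero]
  refine (((hasDerivAt_id z).const_add (ξ : ℂ)).div ((hasDerivAt_id z).const_sub (ξ : ℂ))
    (coe_sub_ne_zero ξ hz)).congr_deriv ?_
  simp only [id]
  ring

lemma differentiableOn_integral_herglotz {μ : Measure Circle} {v : Circle → ℂ}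
    (hv : Integrable v μ) :
    DifferentiableOn ℂ (fun z => ∫ ξ : Circle, herglotzRieszKernel 0 z ξ * v ξ ∂μ) (ball 0 1) := by
  intro z hz
  set δ := (1 - ‖z‖) / 2 with hδdef
  have hδ : 0 < δ := by rw [mem_ball_zero_iff] at hz; linarith
  have hsub : ∀ w ∈ ball z δ, w ∈ ball (0 : ℂ) 1 ∧ ∀ ξ : Circle, δ ≤ ‖(ξ : ℂ) - w‖ := by
    intro w hw
    rw [mem_ball, dist_eq_norm] at hw
    have h1 := norm_sub_norm_le w z
    refine ⟨by rw [mem_ball_zero_iff]; linarith, fun ξ => ?_⟩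
    have h2 := norm_sub_norm_le (ξ : ℂ) w
    rw [Circle.norm_coe] at h2
    linarith
  refine (hasDerivAt_integral_of_dominated_loc_of_deriv_le (ball_mem_nhds z hδ)
    (F' := fun z ξ => 2 * ξ / (ξ - z) ^ 2 * v ξ) (bound := fun ξ => 2 / δ ^ 2 * ‖v ξ‖)
    ?_ ?_ ?_ ?_ (hv.norm.const_mul _) ?_).2.differentiableAt.differentiableWithinAt
  · filter_upwards [ball_mem_nhds z hδ] with w hw
    exact (continuous_herglotzRieszKernel (hsub w hw).1).aestronglyMeasurable.mul hv.1
  · obtain ⟨C, hC⟩ := isCompact_univ.exists_bound_of_continuousOn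
      (continuous_herglotzRieszKernel hz).continuousOn
    exact hv.bdd_mul (continuous_herglotzRieszKernel hz).aestronglyMeasurable
      (ae_of_all _ fun ξ => hC ξ trivial)
  · refine AEStronglyMeasurable.mul (Continuous.aestronglyMeasurable ?_) hv.1
    exact Continuous.div (by fun_prop) (by fun_prop) fun ξ => pow_ne_zero 2 (coe_sub_ne_zero ξ hz)
  · refine ae_of_all _ fun ξ w hw => ?_
    rw [norm_mul, norm_div, norm_pow, norm_mul, Circle.norm_coe]
    have := (hsub w hw).2 ξ
    gcongr
    simp
  · exact ae_of_all _ fun ξ w hw => (hasDerivAt_herglotzRieszKernel ξ (hsub w hw).1).mul_const _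

lemma differentiableOn_herglotz (μ : Measure Circle) [IsFiniteMeasure μ] :
    DifferentiableOn ℂ (herglotz μ) (ball 0 1) := by
  simpa using! differentiableOn_integral_herglotz (μ := μ) (integrable_const (1 : ℂ))

lemma re_herglotz (μ : Measure Circle) [IsFiniteMeasure μ] {z : ℂ} (hz : z ∈ ball (0 : ℂ) 1) :
    (herglotz μ z).re = poissonMeasure μ z := by
  refine (integral_re (integrable_of_continuous (continuous_herglotzRieszKernel hz))).symm.trans ?_
  exact integral_congr_ae (ae_of_all _ fun ξ => re_herglotzRieszKernel _ _)

lemma herglotz_zero (μ : Measure Circle) [IsProbabilityMeasure μ] : herglotz μ 0 = 1 := by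
  simp [herglotz, herglotzRieszKernel_def]

lemma poissonMeasure_pos (μ : Measure Circle) [IsProbabilityMeasure μ] {z : ℂ}
    (hz : z ∈ ball (0 : ℂ) 1) : 0 < poissonMeasure μ z := by
  refine (integral_pos_iff_support_of_nonneg (fun ξ => (poissonKernel_pos hz ξ).le)
    (integrable_of_continuous (continuous_poissonKernel hz))).2 ?_
  rw [Set.eq_univ_of_forall (s := Function.support fun ξ : Circle => poissonKernel 0 z ξ)
    fun ξ => (poissonKernel_pos hz ξ).ne']
  simp

/-- The Poisson integral of an integrable function is the real part of a holomorphic function. -/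
lemma exists_re_eq_poisson {v : Circle → ℝ} (hv : Integrable v lebesgue) :
    ∃ F : ℂ → ℂ, DifferentiableOn ℂ F (ball 0 1) ∧
      ∀ z ∈ ball (0 : ℂ) 1, (F z).re = poisson v z := by
  refine ⟨_, differentiableOn_integral_herglotz hv.ofReal, fun z hz => ?_⟩
  have hi : Integrable (fun ξ : Circle => herglotzRieszKernel 0 z ξ * ((v ξ : ℝ) : ℂ)) lebesgue := by
    obtain ⟨C, hC⟩ := isCompact_univ.exists_bound_of_continuousOn
      (continuous_herglotzRieszKernel hz).continuousOn
    exact hv.ofReal.bdd_mul (continuous_herglotzRieszKernel hz).aestronglyMeasurable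
      (ae_of_all _ fun ξ => hC ξ trivial)
  refine (integral_re hi).symm.trans (integral_congr_ae (ae_of_all _ fun ξ => ?_))
  simp [re_herglotzRieszKernel, mul_comm]

/-- The singular part of μ is dropped, the kernel being positive. -/
lemma poisson_density_le (μ : Measure Circle) [IsFiniteMeasure μ] {z : ℂ}
    (hz : z ∈ ball (0 : ℂ) 1) : poisson (density μ) z ≤ poissonMeasure μ z := by
  have h1 : poisson (density μ) z =
      ∫ ξ : Circle, poissonKernel 0 z ξ ∂lebesgue.withDensity (μ.rnDeriv lebesgue) := by
    rw [integral_withDensity_eq_integral_toReal_smul (Measure.measurable_rnDeriv _ _)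
      (Measure.rnDeriv_lt_top _ _)]
    rfl
  rw [h1]
  exact integral_mono_measure (Measure.withDensity_rnDeriv_le _ _)
    (ae_of_all _ fun ξ => (poissonKernel_pos hz ξ).le)
    (integrable_of_continuous (continuous_poissonKernel hz))

/-- Jensen's inequality: the entropy is nonnegative. -/
lemma poisson_log_density_le {μ : Measure Circle} (hμ : IsSzego μ) {z : ℂ}
    (hz : z ∈ ball (0 : ℂ) 1) :
    poisson (fun ξ => Real.log (density μ ξ)) z ≤ Real.log (poissonMeasure μ z) := by
  have := hμ.isProbabilityMeasure
  set p := poissonMeasure μ z with hp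
  have hp0 : 0 < p := poissonMeasure_pos μ hz
  have hw : Integrable (density μ) lebesgue := Measure.integrable_toReal_rnDeriv
  have hi : Integrable (fun ξ => (Real.log p - 1) + p⁻¹ * density μ ξ) lebesgue :=
    (integrable_const _).add (hw.const_mul _)
  -- The logarithm lies below its tangent at p.
  have h1 : poisson (fun ξ => Real.log (density μ ξ)) z ≤
      poisson (fun ξ => (Real.log p - 1) + p⁻¹ * density μ ξ) z := by
    refine poisson_mono hμ.integrable_log hi ?_ hz
    filter_upwards [hμ.density_pos] with ξ hξ
    have := Real.log_le_sub_one_of_pos (x := p⁻¹ * density μ ξ) (by positivity)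
    rw [Real.log_mul (by positivity) hξ.ne', Real.log_inv] at this
    linarith
  rw [poisson_add (integrable_const _) (hw.const_mul _) hz, poisson_const _ hz,
    poisson_const_mul] at h1
  have h2 : p⁻¹ * poisson (density μ) z ≤ 1 := by
    rw [inv_mul_le_iff₀ hp0, mul_one]
    exact poisson_density_le μ hz
  linarith

/-- Since |w + 1|² - |w - 1|² = 4 Re w; halving w + 1 absorbs the 4. -/
lemma one_sub_norm_sq_cayley {w : ℂ} (hw : 0 < w.re) :
    1 - ‖(w - 1) / (w + 1)‖ ^ 2 = w.re / ‖(w + 1) / 2‖ ^ 2 := by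
  have h : w + 1 ≠ 0 := fun h => by
    have := congrArg Complex.re h
    simp at this
    linarith
  have h' : ‖w + 1‖ ^ 2 ≠ 0 := pow_ne_zero 2 (norm_ne_zero_iff.2 h)
  rw [norm_div, norm_div, div_pow, div_pow, div_div_eq_mul_div, eq_div_iff h', sub_mul,
    div_mul_cancel₀ _ h', Complex.norm_ofNat]
  simp only [← Complex.normSq_eq_norm_sq, Complex.normSq_apply, Complex.sub_re, Complex.sub_im,
    Complex.add_re, Complex.add_im, Complex.one_re, Complex.one_im]
  ring

/-- Uniform bounds for the entropy integrals over smaller circles pass to the boundary. -/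
lemma log_boundaryValue_of_dilation_bound {s : ℂ → ℂ} (hs : DifferentiableOn ℂ s (ball 0 1))
    (h1 : ∀ z ∈ ball (0 : ℂ) 1, ‖s z‖ < 1) {B : ℂ → ℝ}
    (hB : ContinuousOn B (ball 0 1))
    (h : ∀ z ∈ ball (0 : ℂ) 1, ∀ r ∈ Set.Ioo (0 : ℝ) 1,
      poisson (fun ξ => -Real.log (1 - ‖s (r * ξ)‖ ^ 2)) z ≤ B (r * z)) :
    (∀ᵐ ξ ∂lebesgue, ‖boundaryValue s ξ‖ < 1) ∧
    Integrable (fun ξ => Real.log (1 - ‖boundaryValue s ξ‖ ^ 2)) lebesgue ∧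
    ∀ z ∈ ball (0 : ℂ) 1,
      -poisson (fun ξ => Real.log (1 - ‖boundaryValue s ξ‖ ^ 2)) z ≤ B z := by
  have h1' : ∀ z ∈ ball (0 : ℂ) 1, ‖s z‖ ≤ 1 := fun z hz => (h1 z hz).le
  have hlim := ae_tendsto_radial hs h1'
  have hsm := aestronglyMeasurable_boundaryValue hs h1'
  obtain ⟨u, hu1, hu⟩ : ∃ u : ℕ → ℝ, (∀ n, u n ∈ Set.Ioo (0 : ℝ) 1) ∧
      Tendsto u atTop (𝓝[<] 1) := by
    obtain ⟨u, hu⟩ := exists_seq_tendsto (𝓝[<] (1 : ℝ))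
    obtain ⟨N, hN⟩ := eventually_atTop.1 (hu.eventually eventually_Ioo)
    exact ⟨fun n => u (n + N), fun n => hN _ (by simp), hu.comp (tendsto_add_atTop_nat N)⟩
  have hpos : ∀ w : ℂ, ‖w‖ < 1 → 0 < 1 - ‖w‖ ^ 2 := fun w hw => by nlinarith [norm_nonneg w]
  have hneg : ∀ w : ℂ, ‖w‖ < 1 → 0 ≤ -Real.log (1 - ‖w‖ ^ 2) := fun w hw =>
    neg_nonneg.2 (Real.log_nonpos (hpos w hw).le (by nlinarith [norm_nonneg w]))
  set φ : ℕ → Circle → ℝ := fun n ξ => -Real.log (1 - ‖s (u n * ξ)‖ ^ 2) with hφ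
  have hφc : ∀ n, Continuous (φ n) := fun n =>
    (Continuous.log (continuous_const.sub ((continuous_dilation hs (hu1 n)).norm.pow 2))
      fun ξ => (hpos _ (h1 _ (mul_coe_mem_ball (hu1 n) ξ))).ne').neg
  have hφ0 : ∀ n ξ, 0 ≤ φ n ξ := fun n ξ => hneg _ (h1 _ (mul_coe_mem_ball (hu1 n) ξ))
  -- Fatou's lemma is used in `ENNReal`, before integrability of the limit is known.
  have hfatou : ∀ z ∈ ball (0 : ℂ) 1,
      ∫⁻ ξ, liminf (fun n => ENNReal.ofReal (φ n ξ * poissonKernel 0 z ξ)) atTop ∂lebesgue ≤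
        ENNReal.ofReal (B z) := by
    intro z hz
    refine (lintegral_liminf_le fun n =>
      ((hφc n).mul (continuous_poissonKernel hz)).measurable.ennreal_ofReal).trans ?_
    have hBl : Tendsto (fun n => ENNReal.ofReal (B (u n * z))) atTop (𝓝 (ENNReal.ofReal (B z))) := by
      refine ENNReal.tendsto_ofReal ?_
      exact ((hB.continuousAt (isOpen_ball.mem_nhds hz)).tendsto.comp (tendsto_mul_nhdsLT z)).comp hu
    rw [← hBl.liminf_eq]
    refine liminf_le_liminf (Eventually.of_forall fun n => ?_)
    change ∫⁻ ξ : Circle, ENNReal.ofReal (φ n ξ * poissonKernel 0 z ξ) ∂lebesgue ≤ _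
    rw [← ofReal_integral_eq_lintegral_ofReal
      (integrable_mul_poissonKernel (integrable_of_continuous (hφc n)) hz)
      (ae_of_all _ fun ξ => mul_nonneg (hφ0 n ξ) (poissonKernel_pos hz ξ).le)]
    exact ENNReal.ofReal_le_ofReal (h z hz _ (hu1 n))
  have hlt : ∀ᵐ ξ ∂lebesgue, ‖boundaryValue s ξ‖ < 1 := by
    have h0 : (0 : ℂ) ∈ ball (0 : ℂ) 1 := by simp
    have hfin := ae_lt_top (Measurable.liminf fun n =>
      ((hφc n).mul (continuous_poissonKernel h0)).measurable.ennreal_ofReal)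
      ((hfatou 0 h0).trans_lt ENNReal.ofReal_lt_top).ne
    filter_upwards [hlim, hfin] with ξ hξ hξ'
    -- Where the boundary modulus is 1 the functions φ n tend to infinity, against the finiteness of
    -- the lower limit.
    refine (norm_radial_le h1' hξ).lt_of_ne fun heq => hξ'.ne ?_
    refine Tendsto.liminf_eq ?_
    refine ENNReal.tendsto_ofReal_nhds_top.2 ?_
    refine Tendsto.atTop_mul_const (poissonKernel_pos h0 ξ) ?_
    refine tendsto_neg_atBot_atTop.comp (Real.tendsto_log_nhdsGT_zero.comp ?_)
    refine tendsto_nhdsWithin_iff.2 ⟨?_, Eventually.of_forall fun n =>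
      hpos _ (h1 _ (mul_coe_mem_ball (hu1 n) ξ))⟩
    have := ((hξ.comp hu).norm.pow 2).const_sub 1
    simpa [heq] using this
  set ψ : Circle → ℝ := fun ξ => -Real.log (1 - ‖boundaryValue s ξ‖ ^ 2) with hψ
  have hψm : AEStronglyMeasurable ψ lebesgue :=
    (Real.measurable_log.comp_aemeasurable
      ((hsm.norm.pow 2).aemeasurable.const_sub 1)).neg.aestronglyMeasurable
  have hψ0 : ∀ᵐ ξ ∂lebesgue, 0 ≤ ψ ξ := hlt.mono fun ξ hξ => hneg _ hξ
  have hψint : ∀ z ∈ ball (0 : ℂ) 1,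
      ∫⁻ ξ : Circle, ENNReal.ofReal (ψ ξ * poissonKernel 0 z ξ) ∂lebesgue ≤
        ENNReal.ofReal (B z) := by
    intro z hz
    refine (lintegral_congr_ae ?_).trans_le (hfatou z hz)
    filter_upwards [hlim, hlt] with ξ hξ hξ'
    refine (Tendsto.liminf_eq (ENNReal.tendsto_ofReal (Tendsto.mul_const _ ?_))).symm
    exact ((((hξ.comp hu).norm.pow 2).const_sub 1).log (hpos _ hξ').ne').neg
  have hψi : Integrable ψ lebesgue := by
    have h0 : (0 : ℂ) ∈ ball (0 : ℂ) 1 := by simp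
    refine ⟨hψm, ?_⟩
    rw [hasFiniteIntegral_iff_ofReal hψ0]
    refine lt_of_le_of_lt ?_ ((hψint 0 h0).trans_lt ENNReal.ofReal_lt_top)
    -- The Poisson kernel at 0 is identically 1.
    simp [poissonKernel_eq, Circle.norm_coe]
  refine ⟨hlt, by simpa [hψ] using! hψi.neg, fun z hz => ?_⟩
  -- Needed to remove `ENNReal.ofReal`, which truncates negative numbers to zero.
  have hBz : 0 ≤ B z := by
    refine ge_of_tendsto (x := atTop) (f := fun n => B (u n * z)) ?_ (Eventually.of_forall fun n => ?_)
    · exact ((hB.continuousAt (isOpen_ball.mem_nhds hz)).tendsto.comp (tendsto_mul_nhdsLT z)).comp hu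
    · exact (integral_nonneg fun ξ => mul_nonneg (hφ0 n ξ) (poissonKernel_pos hz ξ).le).trans
        (h z hz _ (hu1 n))
  have h2 := hψint z hz
  rw [← ofReal_integral_eq_lintegral_ofReal (integrable_mul_poissonKernel hψi hz)
    (hψ0.mono fun ξ hξ => mul_nonneg hξ (poissonKernel_pos hz ξ).le),
    ENNReal.ofReal_le_ofReal_iff hBz] at h2
  simpa [hψ, poisson, integral_neg] using h2

/-- By Jensen, -log(1 - |s|²) = 2 log|(F + 1)/2| - log P(μ, ·) is at most the harmonic function 2
log|(F + 1)/2| - P(log w, ·), which equals entropy - log(1 - |s|²). -/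
lemma schurEntropyBound_cayley_herglotz {μ : Measure Circle} (hμ : IsSzego μ) :
    SchurEntropyBound (fun z => (herglotz μ z - 1) / (herglotz μ z + 1)) (entropy μ) := by
  have := hμ.isProbabilityMeasure
  have hF := differentiableOn_herglotz μ
  have hre : ∀ z ∈ ball (0 : ℂ) 1, 0 < (herglotz μ z).re := fun z hz =>
    (re_herglotz μ hz).symm ▸ poissonMeasure_pos μ hz
  have hre' : ∀ z ∈ ball (0 : ℂ) 1, 0 < ((herglotz μ z + 1) / 2).re := fun z hz => by
    have := hre z hz
    simp only [Complex.div_ofNat_re, Complex.add_re, Complex.one_re]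
    linarith
  have hne : ∀ z ∈ ball (0 : ℂ) 1, (herglotz μ z + 1) / 2 ≠ 0 := fun z hz h => by
    simpa [h] using hre' z hz
  have hne' : ∀ z ∈ ball (0 : ℂ) 1, herglotz μ z + 1 ≠ 0 := fun z hz h => hne z hz (by simp [h])
  set s : ℂ → ℂ := fun z => (herglotz μ z - 1) / (herglotz μ z + 1) with hs
  have hsd : DifferentiableOn ℂ s (ball 0 1) := (hF.sub_const 1).div (hF.add_const 1) hne'
  have hs1 : ∀ z ∈ ball (0 : ℂ) 1, ‖s z‖ < 1 := fun z hz => by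
    have h1 := one_sub_norm_sq_cayley (hre z hz)
    have h2 := hre z hz
    have h3 := norm_pos_iff.2 (hne z hz)
    have h4 : 0 < 1 - ‖s z‖ ^ 2 := by rw [hs, h1]; positivity
    nlinarith [norm_nonneg (s z)]
  set h : ℂ → ℂ := fun z => Complex.log ((herglotz μ z + 1) / 2) with hh
  have hhd : DifferentiableOn ℂ h (ball 0 1) := ((hF.add_const 1).div_const 2).clog fun z hz =>
    Complex.mem_slitPlane_iff.2 (Or.inl (hre' z hz))
  have hlog : ∀ z ∈ ball (0 : ℂ) 1,
      Real.log (1 - ‖s z‖ ^ 2) = Real.log (poissonMeasure μ z) - 2 * (h z).re := fun z hz => by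
    rw [hs, one_sub_norm_sq_cayley (hre z hz), re_herglotz μ hz,
      Real.log_div (poissonMeasure_pos μ hz).ne' (pow_ne_zero 2 (norm_ne_zero_iff.2 (hne z hz))),
      Real.log_pow, hh, Complex.log_re]
    norm_cast
  obtain ⟨U, hUd, hU⟩ := exists_re_eq_poisson hμ.integrable_log
  -- Re G is that harmonic majorant; being harmonic, its dilation by r has Poisson average Re G(rz).
  set G : ℂ → ℂ := fun z => 2 * h z - U z with hG
  have hGd : DifferentiableOn ℂ G (ball 0 1) := (hhd.const_mul 2).sub hUd
  have hGre : ∀ z, (G z).re = 2 * (h z).re - (U z).re := fun z => by simp [hG]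
  obtain ⟨hlt, hi, hb⟩ := log_boundaryValue_of_dilation_bound hsd hs1
    (B := fun z => (G z).re) (Complex.continuous_re.comp_continuousOn hGd.continuousOn)
    fun z hz r hr => by
      refine (poisson_mono (v := fun ξ => (G (r * ξ)).re) (integrable_of_continuous ?_)
        (integrable_of_continuous (Complex.continuous_re.comp (continuous_dilation hGd hr)))
        (ae_of_all _ fun ξ => ?_) hz).trans_eq (integral_re_dilation hGd hz hr)
      · refine (Continuous.log
          (continuous_const.sub ((continuous_dilation hsd hr).norm.pow 2)) fun ξ => ?_).neg
        have := hs1 _ (mul_coe_mem_ball hr ξ)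
        change 1 - ‖s (r * ξ)‖ ^ 2 ≠ 0
        nlinarith [norm_nonneg (s (r * ξ))]
      · have hm := mul_coe_mem_ball hr ξ
        have := poisson_log_density_le hμ hm
        simp only [hlog _ hm, hGre, hU _ hm]
        linarith
  refine ⟨hsd, fun z hz => (hs1 z hz).le, hlt, hi, fun z hz => (hb z hz).trans_eq ?_⟩
  rw [hlog z hz, hGre, hU z hz, entropy]
  ring

/-- A Schur step is a Möbius map with a = f_n(0) followed by division by z; neither changes K, so
nothing depends on n. -/
theorem schurEntropyBound_schurFamily {μ : Measure Circle} (hμ : IsSzego μ) (n : ℕ) :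
    SchurEntropyBound (schurFamily μ n) (entropy μ) := by
  induction n with
  | zero =>
    have := hμ.isProbabilityMeasure
    exact (schurEntropyBound_cayley_herglotz hμ).dslope (by simp [herglotz_zero])
  | succ n ih => exact (ih.mobius (ih.norm_lt_one (mem_ball_self one_pos))).dslope (by simp)

end UnitCircle

theorem theorem2 :
    ∃ c : ℝ, 0 < c ∧
      ∀ μ : Measure Circle, UnitCircle.IsSzego μ → ∀ n : ℕ,
        -- `f_n` has nontangential boundary values almost everywhere on the circle
        (∀ᵐ ξ ∂UnitCircle.lebesgue, ∃ l : ℂ,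
          Tendsto (UnitCircle.schurFamily μ n) (UnitCircle.nontangential ξ) (𝓝 l)) ∧
        ∀ z ∈ Metric.ball (0 : ℂ) 1,
          Integrable (fun ξ : Circle =>
            ‖UnitCircle.boundaryValue (UnitCircle.schurFamily μ n) ξ
              - UnitCircle.schurFamily μ n z‖) UnitCircle.lebesgue ∧
          UnitCircle.poisson (fun ξ : Circle =>
            ‖UnitCircle.boundaryValue (UnitCircle.schurFamily μ n) ξ
              - UnitCircle.schurFamily μ n z‖) z
            ≤ c * √(UnitCircle.entropy μ z) := by
  -- Integrability is proved alongside the estimate, so the left side is not the default value 0 of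
  -- a divergent integral.
  refine ⟨2, two_pos, fun μ hμ n => ?_⟩
  have h := UnitCircle.schurEntropyBound_schurFamily hμ n
  exact ⟨UnitCircle.ae_exists_tendsto_nontangential h.differentiableOn h.norm_le_one,
    fun z hz => ⟨h.integrable_norm_sub _, h.poisson_norm_sub_le hz⟩⟩
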